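/- Let $D=\langle a,b \mid a^2=b^2=1\rangle$ be the infinite dihedral group, and let $C_k=\mathbb{Z}/k\mathbb{Z}$. Put $d_n=n+1$ for $n\ge 1$, and let $(k_n)_{n\ge 1}$ be any strictly increasing sequence of positive integers with $k_n\ge 2d_n$ for all $n\geq 1$. Let $H_n=D^{k_n}\rtimes C_{k_n}$, where $c\in C_{k_n}$ acts on $D^{k_n}$ by the cyclic permutation $(c\cdot f)(x)=f(x-c)$ of the coordinates, the coordinates $x\in\{1,\dots,k_n\}$ being read modulo $k_n$, and let $\Delta=\mathbb{Z}\times\prod_{n\ge 1}H_n$. Let $\sigma_n\in D^{k_n}\subset H_n$ be defined by $\sigma_n(1)=a$, $\sigma_n(d_n)=b$ and $\sigma_n(j)=1$ for all $j\in\{1,\dots,k_n\}\setminus\{1,d_n\}$. Let $s\in\Delta$ be the element with $\mathbb{Z}$-component $1$ and $H_n$-component $\sigma_n$ for all $n\ge1$, let $t\in\Delta$ be the element with $\mathbb{Z}$-component $0$ and $H_n$-component the generator $1$ of $C_{k_n}$ for all $n\ge 1$, and let $G=\langle s,t\rangle\le\Delta$. Then $G$ is a finitely generated $3$-step solvable group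 (its derived length is exactly $3$) with the following properties: 1. $G$ is torsion-free (its only element of finite order is the identity); 2. $G$ contains a normal subgroup that is free abelian of infinite rank; 3. every finitely generated torsion-free metabelian subquotient of $G$ is virtually abelian. Here a subquotient of $G$ is a group isomorphic to $H/K$ for subgroups $K\lhd H\le G$, a group is metabelian if its second derived subgroup is trivial, and a group is virtually abelian if it has an abelian subgroup of finite index. -/

import Mathlib

/-- A group is torsion-free if its only element of finite order is the identity. -/
def GroupTorsionFree (Q : Type*) [Group Q] : Prop :=
  ∀ g : Q, IsOfFinOrder g → g = 1

/-- A group is metabelian if its second derived subgroup is trivial. -/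
def GroupMetabelian (Q : Type*) [Group Q] : Prop :=
  derivedSeries Q 2 = ⊥

/-- A group is `n`-step solvable if its derived length is exactly `n`. -/
def GroupStepSolvable (Q : Type*) [Group Q] (n : ℕ) : Prop :=
  derivedSeries Q n = ⊥ ∧ ∀ m < n, derivedSeries Q m ≠ ⊥

/-- A group is virtually abelian if it has an abelian subgroup of finite index. -/
def GroupVirtuallyAbelian (Q : Type*) [Group Q] : Prop :=
  ∃ B : Subgroup Q, B.FiniteIndex ∧ ∀ x ∈ B, ∀ y ∈ B, x * y = y * x

/-- `Q` is a subquotient of `G` if `Q ≃ H / K` for subgroups `K ⊴ H ≤ G`. -/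
def GroupSubquotient (Q : Type*) [Group Q] (G : Type*) [Group G] : Prop :=
  ∃ (H : Subgroup G) (K : Subgroup H) (_ : K.Normal), Nonempty (Q ≃* H ⧸ K)

/-- A group is free abelian of infinite rank if it is isomorphic to the free abelian group on
an infinite set. -/
def GroupFreeAbelianInfiniteRank (A : Type*) [Group A] : Prop :=
  ∃ ι : Type, Infinite ι ∧ Nonempty (A ≃* Multiplicative (FreeAbelianGroup ι))

namespace DihedralConstruction

/-- The infinite dihedral group `D`. -/
abbrev D : Type := DihedralGroup 0

/-- The generator `a` of `D = ⟨a, b ∣ a² = b² = 1⟩`, a reflection. -/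
def a : D := DihedralGroup.sr 0

/-- The generator `b` of `D = ⟨a, b ∣ a² = b² = 1⟩`, the reflection such that `a * b` is the
generating rotation `r 1` of infinite order. -/
def b : D := DihedralGroup.sr 1

/-- `H m = D ^ m ⋊ C_m` for `m ≥ 1`. The `m` coordinates are indexed by `ZMod m`, where the
coordinate `j ∈ {1, …, m}` is the one at the residue class of `j`. The element `c` of the cyclic
group `C_m` acts on `D ^ m` by the cyclic permutation `(c • f) x = f (x - c)` of the factors. -/
abbrev H (m : ℕ) : Type :=
  (ZMod m → D) ⋊[mulAutArrow (G := Multiplicative (ZMod m)) (A := ZMod m) (M := D)]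
    Multiplicative (ZMod m)

/-- `Δ = ℤ × ∏_{n ≥ 1} H (k n)`. -/
abbrev Delta (k : ℕ+ → ℕ) : Type :=
  Multiplicative ℤ × ((n : ℕ+) → H (k n))

/-- The element of `D ^ m` with coordinate `a` at `1`, coordinate `b` at `d`, and trivial
elsewhere, for `1 < d ≤ m`. -/
def sigma (m d : ℕ) : ZMod m → D :=
  fun x => if x = 1 then a else if x = (d : ZMod m) then b else 1

/-- The generator `s` of `G`. -/
def s (d k : ℕ+ → ℕ) : Delta k :=
  (Multiplicative.ofAdd 1, fun n => SemidirectProduct.inl (sigma (k n) (d n)))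

/-- The generator `t` of `G`. -/
def t (k : ℕ+ → ℕ) : Delta k :=
  (1, fun _ => SemidirectProduct.inr (Multiplicative.ofAdd 1))

/-- The group `G`, the subgroup of `Δ` generated by `s` and `t`. -/
def G (d k : ℕ+ → ℕ) : Subgroup (Delta k) :=
  Subgroup.closure {s d k, t k}

end DihedralConstruction

/-! Write `s_i = t^i s t^(-i)`. In `H_n` it has `a` at `1 + i` and `b` at `n + 1 + i`, so `s_i` and
`s_j` fail to commute there only if `i - j ≡ ±n` modulo `k_n`. A word in the `s_i` with `|i| ≤ L`
therefore has square trivial in `H_n` for all `n > 2L`. In the finitely many other factors, a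
suitable power of any element commutes with that square, since squares in `D^m` are rotations. So
every element of the kernel of `G → ∏ C_{k_n}` has a locally central square. The image of this map
is cyclic, so any two elements of `G` have a nontrivial product of powers in the kernel. These
properties pass to subquotients, unlike torsion-freeness, and force a finitely generated
torsion-free metabelian group to be virtually abelian: the centralizer of its derived subgroup is
abelian of finite index.

Torsion-freeness of `G` is a parity argument in the abelianization of `D`: the extreme letters
`s_i`, `s_j` of odd exponent meet in `H_(j-i)` and produce an odd rotation, of infinite order. The
`ℤ` factor excludes a single odd letter; without it `s` would be an involution. The commutators of
`s_(i+n)` and `s_i` generate, by triangular elimination, the direct sum of all groups of even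
rotations, which is the free abelian normal subgroup. -/

open scoped commutatorElement

/-! ### Locally central squares and their inheritance by subquotients -/

/-- Every element of the group has a positive power commuting with `x ^ 2`. -/
def SqLocallyCentral {Q : Type*} [Group Q] (x : Q) : Prop :=
  ∀ q : Q, ∃ p : ℕ, 0 < p ∧ Commute (q ^ p) (x ^ 2)

/-- Elements of the derived subgroup, and some nontrivial product of powers of any two elements,
have locally central squares. -/
def LargelySqLocallyCentral (Q : Type*) [Group Q] : Prop :=
  (∀ x ∈ commutator Q, SqLocallyCentral x) ∧
    ∀ q y : Q, ∃ a b : ℤ, (a ≠ 0 ∨ b ≠ 0) ∧ SqLocallyCentral (q ^ a * y ^ b)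

theorem LargelySqLocallyCentral.subgroup {Γ : Type*} [Group Γ] (h : LargelySqLocallyCentral Γ)
    (H : Subgroup Γ) : LargelySqLocallyCentral H := by
  have key : ∀ x : H, SqLocallyCentral (x : Γ) → SqLocallyCentral x := by
    intro x hx q
    obtain ⟨p, hp, hc⟩ := hx q
    exact ⟨p, hp, Subtype.ext (by simpa using hc.eq)⟩
  refine ⟨fun x hx => key x (h.1 _ ?_), fun q y => ?_⟩
  · have : (commutator H).map H.subtype ≤ commutator Γ := by
      rw [commutator_def, commutator_def, Subgroup.map_commutator]
      exact Subgroup.commutator_mono le_top le_top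
    exact this ⟨x, hx, rfl⟩
  · obtain ⟨a, b, hab, hT⟩ := h.2 q y
    exact ⟨a, b, hab, key _ (by simpa using hT)⟩

theorem LargelySqLocallyCentral.of_surjective {Γ Q : Type*} [Group Γ] [Group Q]
    (h : LargelySqLocallyCentral Γ) (f : Γ →* Q) (hf : Function.Surjective f) :
    LargelySqLocallyCentral Q := by
  have key : ∀ x : Γ, SqLocallyCentral x → SqLocallyCentral (f x) := by
    intro x hx q
    obtain ⟨q, rfl⟩ := hf q
    obtain ⟨p, hp, hc⟩ := hx q
    exact ⟨p, hp, by simpa using hc.map f⟩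
  refine ⟨fun x hx => ?_, fun q y => ?_⟩
  · have : (commutator Γ).map f = commutator Q := by
      rw [commutator_def, commutator_def, Subgroup.map_commutator,
        Subgroup.map_top_of_surjective f hf]
    rw [← this] at hx
    obtain ⟨x, hx, rfl⟩ := hx
    exact key x (h.1 x hx)
  · obtain ⟨q, rfl⟩ := hf q
    obtain ⟨y, rfl⟩ := hf y
    obtain ⟨a, b, hab, hT⟩ := h.2 q y
    exact ⟨a, b, hab, by simpa using key _ hT⟩

/-! ### Torsion-free metabelian groups with locally central squares -/

section VirtuallyAbelian

variable {Q : Type*} [Group Q]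

theorem GroupTorsionFree.eq_one_of_pow (htf : GroupTorsionFree Q) {x : Q} {p : ℕ} (hp : 0 < p)
    (h : x ^ p = 1) : x = 1 :=
  htf x (isOfFinOrder_iff_pow_eq_one.mpr ⟨p, hp, h⟩)

theorem GroupMetabelian.commute (hmet : GroupMetabelian Q) {x y : Q} (hx : x ∈ commutator Q)
    (hy : y ∈ commutator Q) : Commute x y := by
  have h : ⁅x, y⁆ ∈ derivedSeries Q 2 := by
    rw [derivedSeries_succ, derivedSeries_one]
    exact Subgroup.commutator_mem_commutator hx hy
  rw [hmet, Subgroup.mem_bot] at h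
  exact commutatorElement_eq_one_iff_commute.mp h

/-- In a torsion-free metabelian group, an element commuting with the square of an element of the
derived subgroup commutes with that element. -/
theorem GroupTorsionFree.commute_of_commute_sq (htf : GroupTorsionFree Q)
    (hmet : GroupMetabelian Q) {x g : Q} (hx : x ∈ commutator Q) (h : Commute g (x ^ 2)) :
    Commute g x := by
  have hy : g * x * g⁻¹ ∈ commutator Q := Subgroup.Normal.conj_mem inferInstance x hx g
  have hc : Commute (g * x * g⁻¹) x⁻¹ := (hmet.commute hy hx).inv_right
  -- `x` and its conjugate lie in the abelian derived subgroup and have the same square, so their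
  -- quotient has square one.
  have h1 : (g * x * g⁻¹ * x⁻¹) ^ 2 = 1 := by
    rw [hc.mul_pow, conj_pow, h.eq]
    group
  have h2 := htf.eq_one_of_pow two_pos h1
  rw [mul_inv_eq_one, mul_inv_eq_iff_eq_mul] at h2
  exact h2

/-- One power `q ^ P` handles the finitely many commutators of generators. It then centralizes the
whole derived subgroup, because the part of that subgroup which it centralizes is normal in `Q`. -/
theorem exists_pow_mem_centralizer_commutator [Group.FG Q] (htf : GroupTorsionFree Q)
    (hmet : GroupMetabelian Q) (hW : LargelySqLocallyCentral Q) (q : Q) :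
    ∃ p : ℕ, 0 < p ∧ q ^ p ∈ Subgroup.centralizer (commutator Q : Set Q) := by
  obtain ⟨S, hS⟩ := Group.FG.out (G := Q)
  have h1 : ∀ z : Q × Q, ∃ p : ℕ, 0 < p ∧ Commute (q ^ p) ⁅z.1, z.2⁆ := by
    intro z
    have hz : ⁅z.1, z.2⁆ ∈ commutator Q :=
      Subgroup.commutator_mem_commutator (Subgroup.mem_top _) (Subgroup.mem_top _)
    obtain ⟨p, hp, hc⟩ := hW.1 _ hz q
    exact ⟨p, hp, htf.commute_of_commute_sq hmet hz hc⟩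
  choose p hp hc using h1
  set P := ∏ z ∈ S ×ˢ S, p z with hP
  have hcP : ∀ x ∈ S, ∀ y ∈ S, Commute (q ^ P) ⁅x, y⁆ := by
    intro x hx y hy
    obtain ⟨m, hm⟩ : p (x, y) ∣ P :=
      Finset.dvd_prod_of_mem p (Finset.mk_mem_product hx hy)
    rw [hm, pow_mul]
    exact (hc (x, y)).pow_left m
  refine ⟨P, Finset.prod_pos fun z _ => hp z, ?_⟩
  let F : Subgroup Q := commutator Q ⊓ Subgroup.centralizer {q ^ P}
  have hFmem : ∀ x, x ∈ F ↔ x ∈ commutator Q ∧ Commute (q ^ P) x := by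
    intro x
    simp only [F, Subgroup.mem_inf, Subgroup.mem_centralizer_singleton_iff]
    exact and_congr_right fun _ => ⟨fun h => h.symm, fun h => h.symm⟩
  -- Conjugating `q ^ P` changes it only by an element of the derived subgroup, which is abelian and
  -- so acts trivially on `F`.
  have hFn : F.Normal := by
    refine ⟨fun x hx g => ?_⟩
    rw [hFmem] at hx ⊢
    refine ⟨Subgroup.Normal.conj_mem inferInstance x hx.1 g, ?_⟩
    have hcm : ⁅g⁻¹, q ^ P⁆ ∈ commutator Q :=
      Subgroup.commutator_mem_commutator (Subgroup.mem_top _) (Subgroup.mem_top _)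
    have h2 : Commute (⁅g⁻¹, q ^ P⁆ * q ^ P) x := (hmet.commute hcm hx.1).mul_left hx.2
    have h3 : ⁅g⁻¹, q ^ P⁆ * q ^ P = g⁻¹ * q ^ P * g := by
      simp [commutatorElement_def, mul_assoc]
    rw [h3] at h2
    have h4 := (Commute.conj_iff g).mpr h2
    simpa [mul_assoc] using h4
  -- The images of the generators commute modulo `F`, so `Q ⧸ F` is abelian.
  have hle : commutator Q ≤ F := by
    have hab : ∀ x y : Q ⧸ F, Commute x y := by
      have hS' : Subgroup.closure ((QuotientGroup.mk' F) '' (S : Set Q)) = ⊤ := by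
        rw [← MonoidHom.map_closure, hS,
          Subgroup.map_top_of_surjective _ (QuotientGroup.mk'_surjective F)]
      have hcomm : ∀ x ∈ (QuotientGroup.mk' F) '' (S : Set Q),
          ∀ y ∈ (QuotientGroup.mk' F) '' (S : Set Q), x * y = y * x := by
        rintro _ ⟨x, hx, rfl⟩ _ ⟨y, hy, rfl⟩
        have : QuotientGroup.mk' F ⁅x, y⁆ = 1 := by
          rw [← MonoidHom.mem_ker, QuotientGroup.ker_mk', hFmem]
          exact ⟨Subgroup.commutator_mem_commutator (Subgroup.mem_top _) (Subgroup.mem_top _),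
            hcP x hx y hy⟩
        rw [map_commutatorElement] at this
        exact commutatorElement_eq_one_iff_mul_comm.mp this
      intro x y
      have hx : x ∈ Subgroup.closure ((QuotientGroup.mk' F) '' (S : Set Q)) := hS' ▸ Subgroup.mem_top _
      have hy : y ∈ Subgroup.closure ((QuotientGroup.mk' F) '' (S : Set Q)) := hS' ▸ Subgroup.mem_top _
      have hcl : ∀ z ∈ (QuotientGroup.mk' F) '' (S : Set Q), Commute x z := by
        intro z hz
        induction hx using Subgroup.closure_induction with
        | mem u hu => exact hcomm u hu z hz
        | one => exact Commute.one_left _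
        | mul u v _ _ hu hv => exact hu.mul_left hv
        | inv u _ hu => exact hu.inv_left
      induction hy using Subgroup.closure_induction with
      | mem u hu => exact hcl u hu
      | one => exact Commute.one_right _
      | mul u v _ _ hu hv => exact hu.mul_right hv
      | inv u _ hu => exact hu.inv_right
    rw [commutator_def, Subgroup.commutator_le]
    intro x _ y _
    rw [← QuotientGroup.ker_mk' F, MonoidHom.mem_ker, map_commutatorElement]
    exact commutatorElement_eq_one_iff_commute.mpr (hab _ _)
  rw [Subgroup.mem_centralizer_iff]
  intro x hx
  exact ((hFmem x).mp (hle hx)).2.symm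

/-- The commutator `c` of `u` and `v` is central in the group they generate. If `m = u ^ a * v ^ b`
has locally central square, conjugation by `m ^ 2` multiplies `v` by `c ^ (2 * a)` and fixes some `v
^ r`, so `c ^ (2 * a * r) = 1` and torsion-freeness gives `c = 1`. When only `b ≠ 0` is known, `u`
and `v` exchange roles. -/
theorem commute_of_mem_centralizer_commutator (htf : GroupTorsionFree Q)
    (hW : LargelySqLocallyCentral Q) {u v : Q}
    (hu : u ∈ Subgroup.centralizer (commutator Q : Set Q))
    (hv : v ∈ Subgroup.centralizer (commutator Q : Set Q)) : Commute u v := by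
  have aux : ∀ (u v m : Q) (a : ℤ), a ≠ 0 →
      u ∈ Subgroup.centralizer (commutator Q : Set Q) →
      v ∈ Subgroup.centralizer (commutator Q : Set Q) → SqLocallyCentral m →
      m * v * m⁻¹ = u ^ a * v * (u ^ a)⁻¹ → m ∈ Subgroup.centralizer (commutator Q : Set Q) →
      Commute u v := by
    intro u v m a ha hu hv hm hmv hmC
    have hc : ⁅u, v⁆ ∈ commutator Q :=
      Subgroup.commutator_mem_commutator (Subgroup.mem_top _) (Subgroup.mem_top _)
    rw [Subgroup.mem_centralizer_iff] at hu hv hmC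
    have hcu : Commute ⁅u, v⁆ u := hu _ hc
    have hcv : Commute ⁅u, v⁆ v := hv _ hc
    have hcm : Commute ⁅u, v⁆ m := hmC _ hc
    set c := ⁅u, v⁆ with hcdef
    have hsemi : SemiconjBy v u (c⁻¹ * u) := by
      simp [SemiconjBy, hcdef, commutatorElement_def, mul_assoc]
    have h1 : SemiconjBy v (u ^ a) (c⁻¹ ^ a * u ^ a) := by
      have := hsemi.zpow_right a
      rwa [hcu.inv_left.mul_zpow] at this
    have h2 : m * v * m⁻¹ = c ^ a * v := by
      rw [hmv, mul_inv_eq_iff_eq_mul, mul_assoc, h1.eq, ← mul_assoc, ← mul_assoc, inv_zpow]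
      simp
    have h3 : m ^ 2 * v * (m ^ 2)⁻¹ = c ^ (2 * a) * v := by
      have : m ^ 2 * v * (m ^ 2)⁻¹ = m * (m * v * m⁻¹) * m⁻¹ := by
        rw [pow_two, mul_inv_rev]
        simp only [mul_assoc]
      rw [this, h2, ← mul_assoc, ← (hcm.zpow_left a).eq, mul_assoc (c ^ a), mul_assoc (c ^ a), h2,
        ← mul_assoc, ← zpow_add, two_mul]
    obtain ⟨r, hr, hcr⟩ := hm v
    have h4 : c ^ (2 * a * r) = 1 := by
      have h5 : m ^ 2 * v ^ r * (m ^ 2)⁻¹ = c ^ (2 * a * r) * v ^ r := by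
        rw [← conj_pow, h3, (hcv.zpow_left _).mul_pow, zpow_mul c (2 * a), zpow_natCast]
      rw [← hcr.eq, mul_inv_cancel_right] at h5
      exact right_eq_mul.mp h5
    have h6 : c = 1 := by
      refine htf c (isOfFinOrder_iff_zpow_eq_one.mpr ⟨_, ?_, h4⟩)
      positivity
    exact commutatorElement_eq_one_iff_commute.mp h6
  obtain ⟨a, b, hab, hm⟩ := hW.2 u v
  have hmC : u ^ a * v ^ b ∈ Subgroup.centralizer (commutator Q : Set Q) :=
    mul_mem (zpow_mem hu a) (zpow_mem hv b)
  rcases hab with ha | hb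
  · refine aux u v _ a ha hu hv hm ?_ hmC
    group
  · refine (aux v u (u ^ a * v ^ b) b hb hv hu hm ?_ hmC).symm
    have hc : ⁅v ^ b, u⁆ ∈ commutator Q :=
      Subgroup.commutator_mem_commutator (Subgroup.mem_top _) (Subgroup.mem_top _)
    have h1 : v ^ b * u * (v ^ b)⁻¹ = ⁅v ^ b, u⁆ * u := by simp [commutatorElement_def]
    have h2 : Commute (u ^ a) (⁅v ^ b, u⁆ * u) := by
      refine Commute.zpow_left (Commute.mul_right ?_ (Commute.refl u)) a
      exact ((Subgroup.mem_centralizer_iff.mp hu) _ hc).symm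
    rw [h1, ← mul_inv_eq_iff_eq_mul.mpr h2.eq, ← h1]
    group

/-- The centralizer of the derived subgroup is abelian of finite index. -/
theorem LargelySqLocallyCentral.virtuallyAbelian (hfg : Group.FG Q) (htf : GroupTorsionFree Q)
    (hmet : GroupMetabelian Q) (hW : LargelySqLocallyCentral Q) : GroupVirtuallyAbelian Q := by
  let C := Subgroup.centralizer (commutator Q : Set Q)
  refine ⟨C, ?_, fun x hx y hy => commute_of_mem_centralizer_commutator htf hW hx hy⟩
  have hle : commutator Q ≤ C := by
    intro x hx
    rw [Subgroup.mem_centralizer_iff]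
    exact fun y hy => hmet.commute hy hx
  have hn : C.Normal := inferInstance
  let _ : CommGroup (Q ⧸ C) :=
    { (inferInstance : Group (Q ⧸ C)) with
      mul_comm := by
        intro x y
        obtain ⟨x, rfl⟩ := QuotientGroup.mk'_surjective C x
        obtain ⟨y, rfl⟩ := QuotientGroup.mk'_surjective C y
        refine commutatorElement_eq_one_iff_mul_comm.mp ?_
        rw [← map_commutatorElement, ← MonoidHom.mem_ker, QuotientGroup.ker_mk']
        exact hle (Subgroup.commutator_mem_commutator (Subgroup.mem_top _) (Subgroup.mem_top _)) }
  -- A finitely generated abelian torsion group is finite.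
  have htor : IsMulTorsion (Q ⧸ C) := by
    intro x
    obtain ⟨x, rfl⟩ := QuotientGroup.mk'_surjective C x
    obtain ⟨p, hp, hx⟩ := exists_pow_mem_centralizer_commutator htf hmet hW x
    refine isOfFinOrder_iff_pow_eq_one.mpr ⟨p, hp, ?_⟩
    have : (QuotientGroup.mk' C) (x ^ p) = 1 := by
      rwa [← MonoidHom.mem_ker, QuotientGroup.ker_mk']
    rwa [map_pow] at this
  have hfg' : Group.FG (Q ⧸ C) := inferInstance
  have : Finite (Q ⧸ C) := CommGroup.finite_of_fg_isMulTorsion (Q ⧸ C) htor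
  exact Subgroup.finiteIndex_of_finite_quotient

end VirtuallyAbelian

/-! ### Words in the conjugates of `s` -/

namespace DihedralConstruction

/-- The conjugate `t ^ i * s * t ^ (-i)`. -/
def sConj (d k : ℕ+ → ℕ) (i : ℤ) : Delta k :=
  t k ^ i * s d k * (t k ^ i)⁻¹

variable {d k : ℕ+ → ℕ}

theorem smul_apply {m : ℕ} (c : Multiplicative (ZMod m)) (f : ZMod m → D) (x : ZMod m) :
    mulAutArrow (G := Multiplicative (ZMod m)) (A := ZMod m) (M := D) c f x =
      f (x - c.toAdd) := by
  change f (-c.toAdd + x) = _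
  rw [neg_add_eq_sub]

theorem t_zpow (i : ℤ) :
    t k ^ i = (1, fun n => SemidirectProduct.inr (Multiplicative.ofAdd (i : ZMod (k n)))) := by
  ext1
  · simp [t]
  · funext n
    change (SemidirectProduct.inr (Multiplicative.ofAdd 1)) ^ i = _
    rw [← map_zpow, ← ofAdd_zsmul, zsmul_one]

theorem sConj_fst (i : ℤ) : (sConj d k i).1 = Multiplicative.ofAdd 1 := by
  simp [sConj, t_zpow, s]

theorem sConj_snd (i : ℤ) (n : ℕ+) :
    (sConj d k i).2 n = SemidirectProduct.inl (fun x => sigma (k n) (d n) (x - i)) := by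
  simp only [sConj, t_zpow, s, Prod.snd_mul, Pi.mul_apply, Prod.snd_inv, Pi.inv_apply]
  rw [← map_inv, ← SemidirectProduct.inl_aut]
  congr 1
  funext x
  rw [smul_apply]
  rfl

theorem s_mem_G : s d k ∈ G d k := Subgroup.subset_closure (by simp)

theorem t_mem_G : t k ∈ G d k := Subgroup.subset_closure (by simp)

theorem sConj_mem_G (i : ℤ) : sConj d k i ∈ G d k :=
  mul_mem (mul_mem (zpow_mem t_mem_G i) s_mem_G) (inv_mem (zpow_mem t_mem_G i))

/-- Powers of `t` are collected on the right: appending `s` to `w * t ^ e` gives `w * sConj e * t ^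
e`. The bound `L` keeps track of the finite window of conjugates used. -/
theorem exists_eq_mul_t_zpow {g : Delta k} (hg : g ∈ G d k) :
    ∃ (L : ℕ) (e : ℤ), ∃ w ∈ Subgroup.closure (sConj d k '' {i | |i| ≤ L}), g = w * t k ^ e := by
  induction hg using Subgroup.closure_induction_right with
  | one => exact ⟨0, 0, 1, one_mem _, by simp⟩
  | mul_right x hx y hy ih =>
    obtain ⟨L, e, w, hw, rfl⟩ := ih
    rcases hy with rfl | rfl
    · refine ⟨max L e.natAbs, e, w * sConj d k e, mul_mem ?_ ?_, ?_⟩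
      · refine Subgroup.closure_mono (Set.image_mono fun i hi => ?_) hw
        simp only [Set.mem_ofPred_eq, abs_le] at hi ⊢
        omega
      · exact Subgroup.subset_closure ⟨e, by simp only [Set.mem_ofPred_eq, abs_le]; omega, rfl⟩
      · simp [sConj, mul_assoc]
    · exact ⟨L, e + 1, w, hw, by rw [zpow_add_one, mul_assoc]⟩
  | mul_inv_cancel x hx y hy ih =>
    obtain ⟨L, e, w, hw, rfl⟩ := ih
    rcases hy with rfl | rfl
    · refine ⟨max L e.natAbs, e, w * (sConj d k e)⁻¹, mul_mem ?_ (inv_mem ?_), ?_⟩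
      · refine Subgroup.closure_mono (Set.image_mono fun i hi => ?_) hw
        simp only [Set.mem_ofPred_eq, abs_le] at hi ⊢
        omega
      · exact Subgroup.subset_closure ⟨e, by simp only [Set.mem_ofPred_eq, abs_le]; omega, rfl⟩
      · simp [sConj, mul_assoc]
    · exact ⟨L, e - 1, w, hw, by rw [zpow_sub_one, mul_assoc]⟩

/-- The homomorphism `Δ → ∏ C_{k n}`. -/
def rightPart (k : ℕ+ → ℕ) : Delta k →* ((n : ℕ+) → Multiplicative (ZMod (k n))) where
  toFun g n := (g.2 n).right
  map_one' := rfl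
  map_mul' _ _ := rfl

theorem rightPart_sConj (i : ℤ) : rightPart k (sConj d k i) = 1 := by
  funext n
  simp [rightPart, sConj_snd]

theorem rightPart_of_mem_closure {S : Set ℤ} {w : Delta k}
    (hw : w ∈ Subgroup.closure (sConj d k '' S)) : rightPart k w = 1 := by
  rw [← MonoidHom.mem_ker]
  refine (Subgroup.closure_le _).mpr ?_ hw
  rintro _ ⟨i, _, rfl⟩
  exact rightPart_sConj i

theorem rightPart_t_zpow (e : ℤ) (n : ℕ+) :
    rightPart k (t k ^ e) n = Multiplicative.ofAdd (e : ZMod (k n)) := by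
  simp [rightPart, t_zpow]

theorem t_zpow_eq_one (e : ℤ) (h : rightPart k (t k ^ e) = 1) : t k ^ e = 1 := by
  rw [t_zpow]
  ext1
  · rfl
  · funext n
    have := congrFun h n
    rw [rightPart_t_zpow] at this
    simp [this]

theorem mem_closure_of_rightPart {g : Delta k} (hg : g ∈ G d k) (hr : rightPart k g = 1) :
    ∃ L : ℕ, g ∈ Subgroup.closure (sConj d k '' {i | |i| ≤ L}) := by
  obtain ⟨L, e, w, hw, rfl⟩ := exists_eq_mul_t_zpow hg
  rw [map_mul, rightPart_of_mem_closure hw, one_mul] at hr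
  exact ⟨L, by simpa [t_zpow_eq_one e hr] using hw⟩

theorem exists_rightPart_eq {g : Delta k} (hg : g ∈ G d k) :
    ∃ e : ℤ, rightPart k g = rightPart k (t k ^ e) := by
  obtain ⟨L, e, w, hw, rfl⟩ := exists_eq_mul_t_zpow hg
  exact ⟨e, by rw [map_mul, rightPart_of_mem_closure hw, one_mul]⟩

theorem intCast_ne_zero_of_abs_lt {m : ℕ} {z : ℤ} (hz : z ≠ 0) (h : |z| < m) :
    (z : ZMod m) ≠ 0 := by
  rw [Ne, ZMod.intCast_zmod_eq_zero_iff_dvd]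
  exact fun hd => hz (Int.eq_zero_of_abs_lt_dvd hd h)

theorem a_mul_a : a * a = 1 := by decide

theorem b_mul_b : b * b = 1 := by decide

theorem sigma_mul_self (m e : ℕ) (x : ZMod m) : sigma m e x * sigma m e x = 1 := by
  unfold sigma
  split_ifs
  · exact a_mul_a
  · exact b_mul_b
  · exact one_mul 1

/-- An `a` meets a `b` only if `i - j ≡ ±n` modulo `k n`. Since `i - j ∓ n` is nonzero of absolute
value below `2 * n < k n`, this is impossible. -/
theorem commute_sConj_snd (hd : ∀ n : ℕ+, d n = (n : ℕ) + 1) (hkd : ∀ n : ℕ+, 2 * d n ≤ k n)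
    {i j : ℤ} {n : ℕ+} (h : |i - j| < n) :
    Commute ((sConj d k i).2 n) ((sConj d k j).2 n) := by
  have hk := hkd n
  rw [hd] at hk
  have hne : ∀ z : ℤ, z ≠ 0 → |z| < 2 * (n : ℕ) + 2 → (z : ZMod (k n)) ≠ 0 := by
    intro z hz hz'
    exact intCast_ne_zero_of_abs_lt hz (by omega)
  rw [abs_lt] at h
  have h1 := hne (i - j - (n : ℕ)) (by omega) (by rw [abs_lt]; omega)
  have h2 := hne (j - i - (n : ℕ)) (by omega) (by rw [abs_lt]; omega)
  push_cast at h1 h2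
  rw [sConj_snd, sConj_snd]
  refine Commute.map ?_ SemidirectProduct.inl
  funext x
  change sigma (k n) (d n) (x - i) * sigma (k n) (d n) (x - j) =
    sigma (k n) (d n) (x - j) * sigma (k n) (d n) (x - i)
  simp only [sigma, hd]
  push_cast
  split_ifs with h3 h4 h5 h6 h7 h8 h9 <;> try simp
  · exact (h1 (by linear_combination h5 - h3)).elim
  · exact (h2 (by linear_combination h6 - h7)).elim

theorem sConj_snd_sq (i : ℤ) (n : ℕ+) : (sConj d k i).2 n * (sConj d k i).2 n = 1 := by
  rw [sConj_snd, ← map_mul, ← map_one SemidirectProduct.inl]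
  congr 1
  funext x
  exact sigma_mul_self _ _ _

/-- Indices in the window differ by at most `2 * L < n`, so in coordinate `n` the word is a product
of commuting elements of square one. -/
theorem sq_snd_eq_one (hd : ∀ n : ℕ+, d n = (n : ℕ) + 1) (hkd : ∀ n : ℕ+, 2 * d n ≤ k n)
    {L : ℕ} {n : ℕ+} (hn : 2 * L < n) {w : Delta k}
    (hw : w ∈ Subgroup.closure (sConj d k '' {i | |i| ≤ L})) : w.2 n * w.2 n = 1 := by
  have hgen : ∀ v ∈ Subgroup.closure (sConj d k '' {i | |i| ≤ L}),
      ∀ i : ℤ, |i| ≤ L → Commute (v.2 n) ((sConj d k i).2 n) := by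
    intro v hv i hi
    induction hv using Subgroup.closure_induction with
    | mem u hu =>
      obtain ⟨j, hj, rfl⟩ := hu
      simp only [Set.mem_ofPred_eq] at hj
      exact commute_sConj_snd hd hkd (by rw [abs_le] at hi hj; rw [abs_lt]; omega)
    | one => exact Commute.one_left _
    | mul u v _ _ hu hv => exact hu.mul_left hv
    | inv u _ hu => exact hu.inv_left
  induction hw using Subgroup.closure_induction_right with
  | one => exact one_mul 1
  | mul_right x hx y hy ih =>
    obtain ⟨i, hi, rfl⟩ := hy
    have hc := hgen x hx i hi
    rw [Prod.snd_mul, Pi.mul_apply, hc.symm.mul_mul_mul_comm, ih, sConj_snd_sq, one_mul]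
  | mul_inv_cancel x hx y hy ih =>
    obtain ⟨i, hi, rfl⟩ := hy
    have hc := (hgen x hx i hi).inv_right
    rw [Prod.snd_mul, Pi.mul_apply, Prod.snd_inv, Pi.inv_apply, hc.symm.mul_mul_mul_comm, ih,
      ← mul_inv_rev, sConj_snd_sq, inv_one, one_mul]

end DihedralConstruction

/-! ### Locally central squares in `G` -/

namespace DihedralConstruction

variable {d k : ℕ+ → ℕ}

theorem left_mul {m : ℕ} {u : H m} (hu : u.right = 1) (v : H m) :
    (u * v).left = u.left * v.left := by
  rw [SemidirectProduct.mul_left, hu, map_one]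
  rfl

theorem left_inv {m : ℕ} {u : H m} (hu : u.right = 1) : u⁻¹.left = u.left⁻¹ := by
  rw [SemidirectProduct.inv_left, hu, inv_one, map_one]
  rfl

theorem eq_inl_of_right_eq_one {m : ℕ} {u : H m} (hu : u.right = 1) :
    u = SemidirectProduct.inl u.left :=
  SemidirectProduct.ext rfl hu

theorem exists_rotation_of_sq (x : D) : ∃ j : ZMod 0, x * x = DihedralGroup.r (2 * j) := by
  rcases x with i | i
  · exact ⟨i, by rw [DihedralGroup.r_mul_r, two_mul]⟩
  · exact ⟨0, by rw [DihedralGroup.sr_mul_sr, sub_self, mul_zero]⟩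

theorem commute_of_rotations {m : ℕ} {u v : H m} (hu : u.right = 1) (hv : v.right = 1)
    (hu' : ∀ x, ∃ j, u.left x = DihedralGroup.r j)
    (hv' : ∀ x, ∃ j, v.left x = DihedralGroup.r j) : Commute u v := by
  rw [eq_inl_of_right_eq_one hu, eq_inl_of_right_eq_one hv]
  refine Commute.map ?_ SemidirectProduct.inl
  funext x
  obtain ⟨i, hi⟩ := hu' x
  obtain ⟨j, hj⟩ := hv' x
  rw [Pi.mul_apply, Pi.mul_apply, hi, hj, DihedralGroup.r_mul_r, DihedralGroup.r_mul_r, add_comm]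

theorem sq_rotations {m : ℕ} {u : H m} (hu : u.right = 1) :
    (u * u).right = 1 ∧ ∀ x, ∃ j, (u * u).left x = DihedralGroup.r j := by
  refine ⟨by rw [SemidirectProduct.mul_right, hu, one_mul], fun x => ?_⟩
  obtain ⟨j, hj⟩ := exists_rotation_of_sq (u.left x)
  exact ⟨_, by rw [left_mul hu]; exact hj⟩

/-- `q ^ m` lies in `D ^ m` because `C_m` has exponent `m`, and squares in `D ^ m` consist of
rotations, which commute. -/
theorem pow_commute_sq {m : ℕ} (q : H m) {u : H m} (hu : u.right = 1) :
    Commute (q ^ (2 * m)) (u ^ 2) := by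
  have hq : (q ^ m).right = 1 := by
    have : (q ^ m).right = q.right ^ m := map_pow SemidirectProduct.rightHom q m
    rw [this]
    change Multiplicative.ofAdd (m • q.right.toAdd) = 1
    simp
  rw [mul_comm, pow_mul, pow_two, pow_two]
  exact commute_of_rotations (sq_rotations hq).1 (sq_rotations hu).1 (sq_rotations hq).2
    (sq_rotations hu).2

theorem sqLocallyCentral_of_rightPart (hd : ∀ n : ℕ+, d n = (n : ℕ) + 1)
    (hkd : ∀ n : ℕ+, 2 * d n ≤ k n) (x : G d k) (hx : rightPart k x = 1) :
    SqLocallyCentral x := by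
  intro q
  obtain ⟨L, hL⟩ := mem_closure_of_rightPart x.2 hx
  let F : Finset ℕ+ := Finset.Iic (Nat.succPNat (2 * L))
  have hk : ∀ n, 0 < k n := fun n => by have := hkd n; rw [hd] at this; omega
  -- This exponent is a multiple of `2 * k n` for each `n ∈ F`; outside `F` the square of `x` is
  -- already trivial.
  refine ⟨∏ n ∈ F, 2 * k n, Finset.prod_pos fun n _ => by have := hk n; omega, ?_⟩
  refine Subtype.ext (Prod.ext (mul_comm _ _) (funext fun n => ?_))
  change Commute (((q : Delta k).2 n) ^ (∏ n ∈ F, 2 * k n)) (((x : Delta k).2 n) ^ 2)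
  by_cases hn : n ∈ F
  · obtain ⟨c, hc⟩ := Finset.dvd_prod_of_mem (fun n => 2 * k n) hn
    rw [hc, pow_mul]
    exact (pow_commute_sq _ (congrFun hx n)).pow_left c
  · have hn' : 2 * L < n := by
      simp only [F, Finset.mem_Iic, not_le, ← PNat.coe_lt_coe, Nat.succPNat_coe] at hn
      omega
    rw [pow_two, sq_snd_eq_one hd hkd hn' hL]
    exact Commute.one_right _

theorem largelySqLocallyCentral_G (hd : ∀ n : ℕ+, d n = (n : ℕ) + 1)
    (hkd : ∀ n : ℕ+, 2 * d n ≤ k n) : LargelySqLocallyCentral (G d k) := by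
  let f := (rightPart k).comp (G d k).subtype
  refine ⟨fun x hx => sqLocallyCentral_of_rightPart hd hkd x ?_, fun q y => ?_⟩
  · exact Abelianization.commutator_subset_ker f hx
  · obtain ⟨e₁, h₁⟩ := exists_rightPart_eq q.2
    obtain ⟨e₂, h₂⟩ := exists_rightPart_eq y.2
    have key : ∀ a b : ℤ, a * e₁ + b * e₂ = 0 → SqLocallyCentral (q ^ a * y ^ b) := by
      intro a b hab
      refine sqLocallyCentral_of_rightPart hd hkd _ ?_
      rw [Subgroup.coe_mul, Subgroup.coe_zpow, Subgroup.coe_zpow, map_mul, map_zpow, map_zpow,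
        h₁, h₂, ← map_zpow, ← map_zpow, ← zpow_mul, ← zpow_mul, ← map_mul, ← zpow_add,
        mul_comm e₁, mul_comm e₂, hab, zpow_zero, map_one]
    by_cases h : e₁ = 0
    · exact ⟨1, 0, Or.inl one_ne_zero, key _ _ (by simp [h])⟩
    -- `q` and `y` project to the images of `t ^ e₁` and `t ^ e₂`, so these exponents cancel.
    · exact ⟨e₂, -e₁, Or.inr (neg_ne_zero.mpr h), key _ _ (by ring)⟩

/-! ### Torsion-freeness by parity -/

/-- The abelianization `D → C₂ × C₂`, with `a ↦ (1, 0)` and `b ↦ (0, 1)`. -/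
def parity : D →* Multiplicative (ZMod 2 × ZMod 2) where
  toFun
    | DihedralGroup.r i => Multiplicative.ofAdd (Int.castRingHom _ i, Int.castRingHom _ i)
    | DihedralGroup.sr i => Multiplicative.ofAdd (1 + Int.castRingHom _ i, Int.castRingHom _ i)
  map_one' := by
    change Multiplicative.ofAdd (Int.castRingHom (ZMod 2) 0, Int.castRingHom (ZMod 2) 0) = 1
    simp
  map_mul' x y := by
    have h2 : ∀ z w : ZMod 2, z - w = z + w := by decide
    have h3 : ∀ z w : ZMod 2, (1 + z) + (1 + w) = z + w := by decide
    rcases x with (i : ℤ) | (i : ℤ) <;> rcases y with (j : ℤ) | (j : ℤ)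
    · change Multiplicative.ofAdd (Int.castRingHom (ZMod 2) (i + j), Int.castRingHom (ZMod 2) (i + j))
        = _
      simp [← ofAdd_add]
    · change Multiplicative.ofAdd
        (1 + Int.castRingHom (ZMod 2) (j - i), Int.castRingHom (ZMod 2) (j - i)) = _
      simp [← ofAdd_add, h2, add_comm, add_assoc]
    · change Multiplicative.ofAdd
        (1 + Int.castRingHom (ZMod 2) (i + j), Int.castRingHom (ZMod 2) (i + j)) = _
      simp [← ofAdd_add, add_assoc]
    · change Multiplicative.ofAdd (Int.castRingHom (ZMod 2) (j - i), Int.castRingHom (ZMod 2) (j - i))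
        = _
      simp [← ofAdd_add, h2, h3, add_comm (j : ZMod 2)]

/-- The two parities differ exactly on reflections, and nontrivial rotations have infinite order. -/
theorem eq_one_of_isOfFinOrder_of_parity {x : D} (hx : IsOfFinOrder x)
    (hp : (parity x).toAdd.1 = (parity x).toAdd.2) : x = 1 := by
  rcases x with i | i
  · obtain ⟨p, hp, h⟩ := isOfFinOrder_iff_pow_eq_one.mp hx
    rw [DihedralGroup.r_pow, DihedralGroup.one_def, DihedralGroup.r.injEq] at h
    have hi : i = 0 := by
      change ℤ at i
      have h' : i * (p : ℤ) = 0 := h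
      exact (mul_eq_zero.mp h').resolve_right (by positivity)
    rw [hi, DihedralGroup.one_def]
  · change 1 + Int.castRingHom (ZMod 2) i = Int.castRingHom (ZMod 2) i at hp
    simp at hp

theorem parity_a : parity a = Multiplicative.ofAdd (1, 0) := by
  change Multiplicative.ofAdd (1 + Int.castRingHom (ZMod 2) 0, Int.castRingHom (ZMod 2) 0) = _
  simp

theorem parity_b : parity b = Multiplicative.ofAdd (0, 1) := by
  change Multiplicative.ofAdd (1 + Int.castRingHom (ZMod 2) 1, Int.castRingHom (ZMod 2) 1) = _
  simp only [map_one]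
  rfl

/-- The parities of the exponents of the `sConj i` in a word determine the abelianized
coordinates of the word. -/
theorem exists_parity_finsupp (hd : ∀ n : ℕ+, d n = (n : ℕ) + 1)
    (hkd : ∀ n : ℕ+, 2 * d n ≤ k n) {S : Set ℤ} {w : Delta k}
    (hw : w ∈ Subgroup.closure (sConj d k '' S)) :
    ∃ P : ℤ →₀ ZMod 2,
      (∀ n x, parity ((w.2 n).left x) = Multiplicative.ofAdd
        (P.mapDomain (fun i : ℤ => (1 : ZMod (k n)) + i) x,
          P.mapDomain (fun i : ℤ => (d n : ZMod (k n)) + i) x)) ∧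
      ((w.1.toAdd : ℤ) : ZMod 2) = P.sum fun _ c => c := by
  induction hw using Subgroup.closure_induction with
  | one =>
    refine ⟨0, fun n x => ?_, ?_⟩
    · change parity 1 = _
      simp only [map_one, Finsupp.mapDomain_zero, Finsupp.coe_zero, Pi.zero_apply]
      rfl
    · simp
  | mem u hu =>
    obtain ⟨i, _, rfl⟩ := hu
    refine ⟨Finsupp.single i 1, fun n x => ?_, ?_⟩
    · have hne : (1 : ZMod (k n)) ≠ d n := by
        have h := intCast_ne_zero_of_abs_lt (m := k n) (z := n) (by simp) (by
          have := hkd n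
          rw [hd] at this
          rw [abs_lt]; omega)
        intro h'
        rw [hd] at h'
        push_cast at h h'
        exact h (by linear_combination -h')
      rw [sConj_snd, SemidirectProduct.left_inl]
      simp only [Finsupp.mapDomain_single, Finsupp.single_apply, sigma, sub_eq_iff_eq_add,
        @eq_comm _ x]
      split_ifs with h1 h2 h3
      · exact (hne (add_right_cancel (h1.trans h2.symm))).elim
      · exact parity_a
      · exact parity_b
      · exact map_one _
    · simp [sConj_fst]
  | mul u v hu hv ihu ihv =>
    obtain ⟨P, hP, hP'⟩ := ihu
    obtain ⟨R, hR, hR'⟩ := ihv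
    refine ⟨P + R, fun n x => ?_, ?_⟩
    · change parity ((u.2 n * v.2 n).left x) = _
      rw [left_mul (congrFun (rightPart_of_mem_closure hu) n), Pi.mul_apply, map_mul, hP, hR,
        Finsupp.mapDomain_add, Finsupp.mapDomain_add]
      rfl
    · rw [Finsupp.sum_add_index' (by simp) (by simp), ← hP', ← hR']
      simp
  | inv u hu ih =>
    obtain ⟨P, hP, hP'⟩ := ih
    have h2 : ∀ z : ZMod 2, -z = z := by decide
    refine ⟨P, fun n x => ?_, ?_⟩
    · change parity ((u.2 n)⁻¹.left x) = _
      rw [left_inv (congrFun (rightPart_of_mem_closure hu) n), Pi.inv_apply, map_inv, hP,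
        ← ofAdd_neg, Prod.neg_mk, h2, h2]
    · rw [← hP', Prod.fst_inv, toAdd_inv, Int.cast_neg, h2]

theorem rightPart_eq_one_of_isOfFinOrder (hd : ∀ n : ℕ+, d n = (n : ℕ) + 1)
    (hkd : ∀ n : ℕ+, 2 * d n ≤ k n) {g : Delta k} (hg : g ∈ G d k) (h : IsOfFinOrder g) :
    rightPart k g = 1 := by
  obtain ⟨e, he⟩ := exists_rightPart_eq hg
  obtain ⟨p, hp, hgp⟩ := isOfFinOrder_iff_pow_eq_one.mp h
  have h1 : rightPart k (t k ^ (e * p)) = 1 := by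
    rw [zpow_mul, map_zpow, ← he, zpow_natCast, ← map_pow, hgp, map_one]
  -- The index is chosen so that `k n > |e * p|`: a congruence to zero modulo `k n` then forces `e *
  -- p = 0`.
  have h2 := congrFun h1 (Nat.succPNat (e * p).natAbs)
  rw [rightPart_t_zpow] at h2
  have h3 : ((e * p : ℤ) : ZMod (k (Nat.succPNat (e * p).natAbs))) = 0 := h2
  have h4 := hkd (Nat.succPNat (e * p).natAbs)
  rw [hd, Nat.succPNat_coe] at h4
  have h5 : e * p = 0 := by
    by_contra hne
    exact intCast_ne_zero_of_abs_lt hne (by rw [Int.abs_eq_natAbs]; omega) h3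
  have h6 : e = 0 := (mul_eq_zero.mp h5).resolve_right (by positivity)
  rw [he, h6, zpow_zero, map_one]

theorem torsionFree_G (hd : ∀ n : ℕ+, d n = (n : ℕ) + 1)
    (hkd : ∀ n : ℕ+, 2 * d n ≤ k n) : GroupTorsionFree (G d k) := by
  rintro ⟨w, hwG⟩ hw
  replace hw : IsOfFinOrder w := (G d k).subtype.isOfFinOrder hw
  have hr := rightPart_eq_one_of_isOfFinOrder hd hkd hwG hw
  obtain ⟨L, hwL⟩ := mem_closure_of_rightPart hwG hr
  obtain ⟨P, hP, hP'⟩ := exists_parity_finsupp hd hkd hwL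
  obtain ⟨p, hp, hwp⟩ := isOfFinOrder_iff_pow_eq_one.mp hw
  have hfin : ∀ n x, IsOfFinOrder ((w.2 n).left x) := by
    intro n x
    refine isOfFinOrder_iff_pow_eq_one.mpr ⟨p, hp, ?_⟩
    have h1 : (w.2 n) ^ p = 1 := congrFun (congrArg Prod.snd hwp) n
    rw [eq_inl_of_right_eq_one (congrFun hr n), ← map_pow] at h1
    exact congrFun (congrArg SemidirectProduct.left h1) x
  have hz : w.1.toAdd = 0 := by
    have h1 : p • w.1.toAdd = 0 := congrArg (fun y : Delta k => y.1.toAdd) hwp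
    exact (smul_eq_zero.mp h1).resolve_left hp.ne'
  have h01 : ∀ z : ZMod 2, z ≠ 0 → z = 1 := by decide
  have hP0 : P = 0 := by
    by_contra hne
    have hs : P.support.Nonempty := Finsupp.support_nonempty_iff.mpr hne
    set i := P.support.min' hs with hi
    set j := P.support.max' hs with hj
    have hPi : P i = 1 := h01 _ (Finsupp.mem_support_iff.mp (Finset.min'_mem _ hs))
    have hPj : P j = 1 := h01 _ (Finsupp.mem_support_iff.mp (Finset.max'_mem _ hs))
    -- A one-point support would make the `ℤ`-component odd, but it is zero.
    have hij : i < j := by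
      refine lt_of_le_of_ne (Finset.min'_le_max' _ hs) fun heq => ?_
      have hsub : P.support = {i} := by
        refine Finset.eq_singleton_iff_unique_mem.mpr ⟨Finset.min'_mem _ hs, fun l hl => ?_⟩
        exact le_antisymm (heq ▸ Finset.le_max' _ l hl) (Finset.min'_le _ l hl)
      rw [Finsupp.sum, hsub, Finset.sum_singleton, hPi, hz] at hP'
      exact absurd hP' (by decide)
    obtain ⟨n, hn⟩ : ∃ n : ℕ+, (n : ℤ) = j - i :=
      ⟨⟨(j - i).toNat, by omega⟩, by simp; omega⟩
    have hk := hkd n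
    rw [hd] at hk
    -- The support lies in an interval of length `n < k n`, so nothing wraps around.
    have hinj : ∀ c : ZMod (k n), Set.InjOn (fun l : ℤ => c + l) P.support := by
      intro c l hl l' hl' hll
      by_contra hne'
      have h1 := Finset.min'_le _ l hl
      have h2 := Finset.min'_le _ l' hl'
      have h3 := Finset.le_max' _ l hl
      have h4 := Finset.le_max' _ l' hl'
      refine intCast_ne_zero_of_abs_lt (m := k n) (sub_ne_zero.mpr hne') ?_ ?_
      · rw [abs_lt]; omega
      · push_cast
        exact sub_eq_zero.mpr (add_left_cancel hll)
    have hA := Finsupp.mapDomain_apply' _ P subset_rfl (hinj 1) (Finset.max'_mem _ hs)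
    have hB := Finsupp.mapDomain_apply' _ P subset_rfl (hinj (d n)) (Finset.min'_mem _ hs)
    have hx : (d n : ZMod (k n)) + (i : ℤ) = 1 + (j : ℤ) := by
      have h1 : ((n : ℤ) : ZMod (k n)) = ((j - i : ℤ) : ZMod (k n)) := congrArg _ hn
      rw [hd]
      push_cast at h1 ⊢
      linear_combination h1
    -- At this position the `a` of the last odd letter meets the `b` of the first one. The parity is
    -- `(1, 1)`, that of an odd rotation.
    have hpar := hP n (1 + (j : ℤ))
    simp only [← hi, ← hj] at hA hB
    rw [hx] at hB
    rw [hA, hB, hPi, hPj] at hpar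
    have h1 := eq_one_of_isOfFinOrder_of_parity (hfin n (1 + (j : ℤ))) (by rw [hpar]; rfl)
    rw [h1, map_one] at hpar
    exact absurd hpar (by decide)
  refine Subtype.ext (Prod.ext hz (funext fun n => ?_))
  refine SemidirectProduct.ext (funext fun x => ?_) (congrFun hr n)
  refine eq_one_of_isOfFinOrder_of_parity (hfin n x) ?_
  rw [hP, hP0]
  simp

end DihedralConstruction

/-! ### Even rotations and the free abelian normal subgroup -/

namespace DihedralConstruction

variable {d k : ℕ+ → ℕ}

/-- The elements of `D ^ m` all of whose coordinates are even rotations. -/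
def evenRotations (m : ℕ) : Subgroup (H m) where
  carrier := {u | u.right = 1 ∧ ∀ x, ∃ j : ZMod 0, u.left x = DihedralGroup.r (2 * j)}
  one_mem' := ⟨rfl, fun _ => ⟨0, by rw [mul_zero, DihedralGroup.r_zero]; rfl⟩⟩
  mul_mem' {u v} hu hv := by
    refine ⟨by rw [SemidirectProduct.mul_right, hu.1, hv.1, one_mul], fun x => ?_⟩
    obtain ⟨i, hi⟩ := hu.2 x
    obtain ⟨j, hj⟩ := hv.2 x
    exact ⟨i + j, by rw [left_mul hu.1, Pi.mul_apply, hi, hj, DihedralGroup.r_mul_r, mul_add]⟩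
  inv_mem' {u} hu := by
    refine ⟨by rw [SemidirectProduct.inv_right, hu.1, inv_one], fun x => ?_⟩
    obtain ⟨i, hi⟩ := hu.2 x
    exact ⟨-i, by rw [left_inv hu.1, Pi.inv_apply, hi, DihedralGroup.inv_r, mul_neg]⟩

theorem even_rotation_injective {i j : ZMod 0}
    (h : (DihedralGroup.r (2 * i) : D) = DihedralGroup.r (2 * j)) : i = j := by
  change ℤ at i j
  have h' : (2 : ℤ) * i = 2 * j := DihedralGroup.r.inj h
  exact Int.eq_of_mul_eq_mul_left two_ne_zero h'

theorem conj_even_rotation (y : D) (j : ZMod 0) :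
    ∃ l : ZMod 0, y * DihedralGroup.r (2 * j) * y⁻¹ = DihedralGroup.r (2 * l) := by
  rcases y with i | i
  · exact ⟨j, by rw [DihedralGroup.inv_r, DihedralGroup.r_mul_r, DihedralGroup.r_mul_r]; congr 1; ring⟩
  · exact ⟨-j, by
      rw [DihedralGroup.inv_sr, DihedralGroup.sr_mul_r, DihedralGroup.sr_mul_sr]; congr 1; ring⟩

theorem commutator_even_rotation (x y : D) :
    ∃ l : ZMod 0, ⁅x, y⁆ = DihedralGroup.r (2 * l) := by
  rw [commutatorElement_def]
  rcases x with i | i <;> rcases y with j | j <;>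
    simp only [DihedralGroup.inv_r, DihedralGroup.inv_sr, DihedralGroup.r_mul_r,
      DihedralGroup.r_mul_sr, DihedralGroup.sr_mul_r, DihedralGroup.sr_mul_sr]
  · exact ⟨0, by congr 1; ring⟩
  · exact ⟨i, by congr 1; ring⟩
  · exact ⟨-j, by congr 1; ring⟩
  · exact ⟨j - i, by congr 1; ring⟩

instance evenRotations_normal (m : ℕ) : (evenRotations m).Normal := by
  refine ⟨fun u hu g => ⟨?_, fun x => ?_⟩⟩
  · simp [hu.1]
  · have h : g * u * g⁻¹ = SemidirectProduct.inl (g.left * (mulAutArrow g.right u.left) * g.left⁻¹) := by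
      conv_lhs => rw [← SemidirectProduct.inl_left_mul_inr_right g, eq_inl_of_right_eq_one hu.1]
      rw [map_mul, map_mul, SemidirectProduct.inl_aut, map_inv, map_inv]
      group
    obtain ⟨j, hj⟩ := hu.2 (x - g.right.toAdd)
    rw [h, SemidirectProduct.left_inl, Pi.mul_apply, Pi.mul_apply, smul_apply, hj]
    exact conj_even_rotation _ j

theorem commutator_mem_evenRotations {m : ℕ} {u v : H m} (hu : u.right = 1) (hv : v.right = 1) :
    ⁅u, v⁆ ∈ evenRotations m := by
  rw [eq_inl_of_right_eq_one hu, eq_inl_of_right_eq_one hv, ← map_commutatorElement]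
  exact ⟨rfl, fun x => commutator_even_rotation _ _⟩

theorem commute_of_mem_evenRotations {m : ℕ} {u v : H m} (hu : u ∈ evenRotations m)
    (hv : v ∈ evenRotations m) : Commute u v :=
  commute_of_rotations hu.1 hv.1 (fun x => (hu.2 x).imp' (2 * ·) fun _ h => h)
    (fun x => (hv.2 x).imp' (2 * ·) fun _ h => h)

/-- The elements of `Δ` all of whose coordinates are even rotations. -/
def deltaEvenRotations (k : ℕ+ → ℕ) : Subgroup (Delta k) where
  carrier := {y | y.1 = 1 ∧ ∀ n, y.2 n ∈ evenRotations (k n)}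
  one_mem' := ⟨rfl, fun _ => one_mem _⟩
  mul_mem' hu hv := ⟨by rw [Prod.fst_mul, hu.1, hv.1, one_mul], fun n => mul_mem (hu.2 n) (hv.2 n)⟩
  inv_mem' hu := ⟨by rw [Prod.fst_inv, hu.1, inv_one], fun n => inv_mem (hu.2 n)⟩

theorem commutator_mem_deltaEvenRotations {u v : Delta k} (hu : rightPart k u = 1)
    (hv : rightPart k v = 1) : ⁅u, v⁆ ∈ deltaEvenRotations k :=
  ⟨by
    change ⁅u.1, v.1⁆ = 1
    exact commutatorElement_eq_one_iff_commute.mpr (Commute.all _ _),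
  fun n => commutator_mem_evenRotations (congrFun hu n) (congrFun hv n)⟩

/-- The direct sum of the groups of even rotations, as a subgroup of `Δ`. -/
def finEvenRotations (k : ℕ+ → ℕ) : Subgroup (Delta k) where
  carrier := {y | y ∈ deltaEvenRotations k ∧ ∃ m : ℕ, ∀ n : ℕ+, m < n → y.2 n = 1}
  one_mem' := ⟨one_mem _, 0, fun _ _ => rfl⟩
  mul_mem' := by
    rintro u v ⟨hu, m, hm⟩ ⟨hv, l, hl⟩
    refine ⟨mul_mem hu hv, max m l, fun n hn => ?_⟩
    rw [Prod.snd_mul, Pi.mul_apply, hm n (by omega), hl n (by omega), one_mul]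
  inv_mem' := by
    rintro u ⟨hu, m, hm⟩
    refine ⟨inv_mem hu, m, fun n hn => ?_⟩
    rw [Prod.snd_inv, Pi.inv_apply, hm n hn, inv_one]

instance finEvenRotations_normal : (finEvenRotations k).Normal := by
  refine ⟨fun u hu g => ?_⟩
  obtain ⟨hu, m, hm⟩ := hu
  refine ⟨⟨?_, fun n => (evenRotations_normal (k n)).conj_mem _ (hu.2 n) (g.2 n)⟩, m, fun n hn => ?_⟩
  · rw [Prod.fst_mul, Prod.fst_mul, hu.1, mul_one, Prod.fst_inv, mul_inv_cancel]
  · rw [Prod.snd_mul, Prod.snd_mul, Pi.mul_apply, Pi.mul_apply, hm n hn, mul_one, Prod.snd_inv,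
      Pi.inv_apply, mul_inv_cancel]

theorem commutator_sConj_snd_eq_one (hd : ∀ n : ℕ+, d n = (n : ℕ) + 1)
    (hkd : ∀ n : ℕ+, 2 * d n ≤ k n) {i j : ℤ} {n : ℕ+} (h : |i - j| < n) :
    (⁅sConj d k i, sConj d k j⁆).2 n = 1 :=
  commutatorElement_eq_one_iff_commute.mpr (commute_sConj_snd hd hkd h)

/-- The `a` of the first conjugate meets the `b` of the second at `i + n + 1` only, giving `⁅a, b⁆ =
r 2`. The opposite overlap would need `2 * n ≡ 0` modulo `k n`. -/
theorem commutator_sConj_snd (hd : ∀ n : ℕ+, d n = (n : ℕ) + 1)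
    (hkd : ∀ n : ℕ+, 2 * d n ≤ k n) (i : ℤ) (n : ℕ+) :
    (⁅sConj d k (i + (n : ℕ)), sConj d k i⁆).2 n =
      SemidirectProduct.inl fun x => DihedralGroup.r
        (2 * (Pi.single (i + (n : ℕ) + 1 : ZMod (k n)) 1 : ZMod (k n) → ZMod 0) x) := by
  change ⁅(sConj d k (i + (n : ℕ))).2 n, (sConj d k i).2 n⁆ = _
  rw [sConj_snd, sConj_snd, ← map_commutatorElement]
  congr 1
  funext x
  change ⁅sigma (k n) (d n) (x - (i + (n : ℕ) : ℤ)), sigma (k n) (d n) (x - i)⁆ = _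
  have hk := hkd n
  rw [hd] at hk
  have h0 := n.pos
  have h1 := intCast_ne_zero_of_abs_lt (m := k n) (z := (n : ℕ)) (by simp) (by rw [abs_lt]; omega)
  have h2 := intCast_ne_zero_of_abs_lt (m := k n) (z := 2 * (n : ℕ)) (by simp)
    (by rw [abs_lt]; omega)
  push_cast at h1 h2 ⊢
  by_cases hx : x = i + (n : ℕ) + 1
  · have ha : sigma (k n) (d n) (x - (i + (n : ℕ))) = a := by
      rw [sigma, if_pos (by rw [hx]; ring)]
    have hb : sigma (k n) (d n) (x - i) = b := by
      rw [sigma, if_neg, if_pos]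
      · rw [hx, hd]; push_cast; ring
      · rw [hx]
        intro h
        exact h1 (by linear_combination h)
    rw [ha, hb, hx, Pi.single_eq_same]
    decide
  · rw [Pi.single_eq_of_ne hx, mul_zero, DihedralGroup.r_zero]
    refine commutatorElement_eq_one_iff_mul_comm.mpr ?_
    have ha : ¬ (x - (i + (n : ℕ)) = 1) := fun h => hx (by linear_combination h)
    simp only [sigma, if_neg ha, hd]
    push_cast
    split_ifs with h3 h4 <;> try simp
    exact (h2 (by linear_combination h4 - h3)).elim

/-- Products of the commutators of `sConj (i + n)` and `sConj i` realize any prescribed even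
rotations in `H (k n)`. They vanish above `n`, while the coordinates below `n` are not controlled.
-/
theorem exists_mem_G_of_coordinates (hd : ∀ n : ℕ+, d n = (n : ℕ) + 1)
    (hkd : ∀ n : ℕ+, 2 * d n ≤ k n) (n : ℕ+) (h : ZMod (k n) → ZMod 0) :
    ∃ g ∈ G d k, g ∈ finEvenRotations k ∧ (∀ n' : ℕ+, n < n' → g.2 n' = 1) ∧
      g.2 n = SemidirectProduct.inl fun x => DihedralGroup.r (2 * h x) := by
  have : NeZero (k n) := ⟨by have := hkd n; rw [hd] at this; omega⟩
  let A : AddSubgroup (ZMod (k n) → ZMod 0) :=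
    { carrier := {h | ∃ g ∈ G d k, g ∈ finEvenRotations k ∧ (∀ n' : ℕ+, n < n' → g.2 n' = 1) ∧
        g.2 n = SemidirectProduct.inl fun x => DihedralGroup.r (2 * h x)}
      zero_mem' := by
        refine ⟨1, one_mem _, one_mem _, fun _ _ => rfl, ?_⟩
        simp only [Pi.zero_apply, mul_zero, DihedralGroup.r_zero]
        exact (map_one _).symm
      add_mem' := by
        rintro h h' ⟨g, hg, hE, h1, h2⟩ ⟨g', hg', hE', h1', h2'⟩
        refine ⟨g * g', mul_mem hg hg', mul_mem hE hE', fun n' hn' => ?_, ?_⟩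
        · rw [Prod.snd_mul, Pi.mul_apply, h1 n' hn', h1' n' hn', one_mul]
        · rw [Prod.snd_mul, Pi.mul_apply, h2, h2', ← map_mul]
          congr 1
          funext x
          rw [Pi.mul_apply, DihedralGroup.r_mul_r, Pi.add_apply, mul_add]
      neg_mem' := by
        rintro h ⟨g, hg, hE, h1, h2⟩
        refine ⟨g⁻¹, inv_mem hg, inv_mem hE, fun n' hn' => ?_, ?_⟩
        · rw [Prod.snd_inv, Pi.inv_apply, h1 n' hn', inv_one]
        · rw [Prod.snd_inv, Pi.inv_apply, h2, ← map_inv]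
          congr 1
          funext x
          rw [Pi.inv_apply, DihedralGroup.inv_r, Pi.neg_apply, mul_neg] }
  have hsingle : ∀ x, Pi.single x 1 ∈ A := by
    intro x
    obtain ⟨i, hi⟩ := ZMod.intCast_surjective (x - ((n : ℕ) + 1) : ZMod (k n))
    have hx : x = i + (n : ℕ) + 1 := by rw [hi]; ring
    have htriv : ∀ n' : ℕ+, n < n' → (⁅sConj d k (i + (n : ℕ)), sConj d k i⁆).2 n' = 1 := by
      intro n' hn'
      have : (n : ℕ) < n' := hn'
      exact commutator_sConj_snd_eq_one hd hkd (by rw [abs_lt]; omega)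
    refine ⟨⁅sConj d k (i + (n : ℕ)), sConj d k i⁆, ?_, ⟨?_, n, htriv⟩, htriv, ?_⟩
    · exact mul_mem (mul_mem (mul_mem (sConj_mem_G _) (sConj_mem_G _))
        (inv_mem (sConj_mem_G _))) (inv_mem (sConj_mem_G _))
    · exact commutator_mem_deltaEvenRotations (rightPart_sConj _) (rightPart_sConj _)
    · rw [commutator_sConj_snd hd hkd, hx]
  change h ∈ A
  rw [← Finset.univ_sum_single h]
  refine sum_mem fun x _ => ?_
  have hx : (Pi.single x (h x) : ZMod (k n) → ZMod 0) = (h x).cast (R := ℤ) • Pi.single x 1 := by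
    rw [← Pi.single_smul, zsmul_one, ZMod.intCast_zmod_cast]
  rw [hx]
  exact zsmul_mem (hsingle x) _

/-- Triangular elimination: the highest nontrivial coordinate is cancelled by an element of `G` that
vanishes above it, which lowers the bound `m`. -/
theorem finEvenRotations_le_G (hd : ∀ n : ℕ+, d n = (n : ℕ) + 1)
    (hkd : ∀ n : ℕ+, 2 * d n ≤ k n) : finEvenRotations k ≤ G d k := by
  have key : ∀ m : ℕ, ∀ y ∈ finEvenRotations k, (∀ n : ℕ+, m < n → y.2 n = 1) → y ∈ G d k := by
    intro m
    induction m with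
    | zero =>
      intro y hy hm
      have : y = 1 := Prod.ext hy.1.1 (funext fun n => hm n n.pos)
      rw [this]
      exact one_mem _
    | succ m ih =>
      intro y hy hm
      choose h hh using (hy.1.2 (Nat.succPNat m)).2
      obtain ⟨g, hg, hE, h1, h2⟩ := exists_mem_G_of_coordinates hd hkd _ h
      have hy' : y * g⁻¹ ∈ G d k := by
        refine ih _ (mul_mem hy (inv_mem hE)) fun n hn => ?_
        rw [Prod.snd_mul, Pi.mul_apply, Prod.snd_inv, Pi.inv_apply, mul_inv_eq_one]
        rcases eq_or_lt_of_le (Nat.succ_le_of_lt hn) with hn' | hn'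
        · obtain rfl : Nat.succPNat m = n := PNat.eq hn'
          rw [h2, eq_inl_of_right_eq_one (hy.1.2 _).1]
          congr 1
          exact funext hh
        · rw [hm n hn', h1 n hn']
      simpa using mul_mem hy' hg
  intro y hy
  obtain ⟨m, hm⟩ := hy.2
  exact key m y hy hm

theorem isFreeAbelian_finEvenRotations (hk : ∀ n, k n ≠ 0) :
    GroupFreeAbelianInfiniteRank (finEvenRotations k) := by
  have : ∀ n, NeZero (k n) := fun n => ⟨hk n⟩
  refine ⟨Σ n : ℕ+, ZMod (k n), Infinite.of_injective (fun n : ℕ+ => ⟨n, 0⟩) fun n n' h =>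
    congrArg Sigma.fst h, ?_⟩
  let ρ : Multiplicative ((Σ n : ℕ+, ZMod (k n)) →₀ ℤ) →* finEvenRotations k :=
    { toFun f := ⟨(1, fun n => SemidirectProduct.inl fun x =>
          DihedralGroup.r (2 * (Int.cast (f.toAdd ⟨n, x⟩) : ZMod 0))),
        ⟨rfl, fun n => ⟨rfl, fun x => ⟨_, rfl⟩⟩⟩, f.toAdd.support.sup fun p => (p.1 : ℕ), by
          intro n hn
          change SemidirectProduct.inl _ = 1
          rw [← map_one SemidirectProduct.inl]
          congr 1
          funext x
          have : f.toAdd ⟨n, x⟩ = 0 := by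
            by_contra hne
            have := Finset.le_sup (f := fun p : Σ n : ℕ+, ZMod (k n) => (p.1 : ℕ))
              (Finsupp.mem_support_iff.mpr hne)
            exact absurd hn (not_lt.mpr this)
          change DihedralGroup.r (2 * (Int.cast (f.toAdd ⟨n, x⟩) : ZMod 0)) = 1
          rw [this, Int.cast_zero, mul_zero, DihedralGroup.r_zero]⟩
      map_one' := by
        refine Subtype.ext (Prod.ext rfl (funext fun n => ?_))
        change SemidirectProduct.inl _ = 1
        rw [← map_one SemidirectProduct.inl]
        rfl
      map_mul' f g := by
        refine Subtype.ext (Prod.ext rfl (funext fun n => ?_))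
        change SemidirectProduct.inl _ = SemidirectProduct.inl _ * SemidirectProduct.inl _
        rw [← map_mul]
        congr 1
        funext x
        rw [Pi.mul_apply, DihedralGroup.r_mul_r, toAdd_mul, Finsupp.add_apply, Int.cast_add,
          mul_add] }
  have hinj : Function.Injective ρ := by
    intro f g hfg
    refine Multiplicative.toAdd.injective (Finsupp.ext ?_)
    rintro ⟨n, x⟩
    have h1 := congrFun (congrArg SemidirectProduct.left
      (congrFun (congrArg (fun y : finEvenRotations k => (y : Delta k).2) hfg) n)) x
    exact even_rotation_injective h1
  have hsurj : Function.Surjective ρ := by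
    rintro ⟨y, hy, m, hm⟩
    choose h hh using fun n => (hy.2 n).2
    let f : (Σ n : ℕ+, ZMod (k n)) →₀ ℤ :=
      Finsupp.onFinset ((Finset.Iic (Nat.succPNat m)).sigma fun _ => Finset.univ)
        (fun p => (h p.1 p.2).cast) (by
          rintro ⟨n, x⟩ hne
          simp only [Finset.mem_sigma, Finset.mem_Iic, Finset.mem_univ, and_true]
          by_contra hlt
          rw [not_le, ← PNat.coe_lt_coe, Nat.succPNat_coe] at hlt
          have h1 := hh n x
          rw [hm n (by omega)] at h1
          have h2 : (0 : ZMod 0) = h n x := even_rotation_injective h1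
          exact hne (by rw [← h2]; rfl))
    refine ⟨Multiplicative.ofAdd f, Subtype.ext (Prod.ext hy.1.symm (funext fun n => ?_))⟩
    refine SemidirectProduct.ext (funext fun x => ?_) (hy.2 n).1.symm
    change DihedralGroup.r (2 * (Int.cast (h n x).cast : ZMod 0)) = (y.2 n).left x
    rw [ZMod.intCast_zmod_cast, hh]
  exact ⟨(MulEquiv.ofBijective ρ ⟨hinj, hsurj⟩).symm.trans
    (AddEquiv.toMultiplicative (FreeAbelianGroup.equivFinsupp _).symm)⟩

/-! ### Derived length -/

theorem stepSolvable_G (hd : ∀ n : ℕ+, d n = (n : ℕ) + 1)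
    (hkd : ∀ n : ℕ+, 2 * d n ≤ k n) : GroupStepSolvable (G d k) 3 := by
  constructor
  · have h1 : derivedSeries (G d k) 1 ≤ ((rightPart k).comp (G d k).subtype).ker := by
      rw [derivedSeries_one]
      exact Abelianization.commutator_subset_ker _
    have h2 : derivedSeries (G d k) 2 ≤ (deltaEvenRotations k).comap (G d k).subtype := by
      rw [derivedSeries_succ, Subgroup.commutator_le]
      intro x hx y hy
      exact commutator_mem_deltaEvenRotations (h1 hx) (h1 hy)
    rw [derivedSeries_succ, eq_bot_iff, Subgroup.commutator_le]
    intro x hx y hy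
    rw [Subgroup.mem_bot, commutatorElement_eq_one_iff_commute]
    exact Subtype.ext (Prod.ext (mul_comm _ _) (funext fun n =>
      commute_of_mem_evenRotations ((h2 hx).2 n) ((h2 hy).2 n)))
  · intro m hm hbot
    have h2 : GroupMetabelian (G d k) :=
      eq_bot_iff.mpr (hbot ▸ derivedSeries_antitone _ (Nat.le_of_lt_succ hm))
    have hmem : ∀ i : ℤ, (⟨sConj d k (1 + i) * (sConj d k i)⁻¹,
        mul_mem (sConj_mem_G _) (inv_mem (sConj_mem_G _))⟩ : G d k) ∈ commutator (G d k) := by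
      intro i
      have h : (⟨sConj d k (1 + i) * (sConj d k i)⁻¹,
          mul_mem (sConj_mem_G _) (inv_mem (sConj_mem_G _))⟩ : G d k) =
          ⁅(⟨t k, t_mem_G⟩ : G d k), ⟨sConj d k i, sConj_mem_G i⟩⁆ := by
        refine Subtype.ext ?_
        change _ = t k * sConj d k i * (t k)⁻¹ * (sConj d k i)⁻¹
        simp only [sConj, zpow_one_add, mul_inv_rev, mul_assoc]
      rw [h]
      exact Subgroup.commutator_mem_commutator (Subgroup.mem_top _) (Subgroup.mem_top _)
    -- In `H (k 1)`, at position `2 = d 1`, the conjugates with index `0`, `1`, `2` have values `b`,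
    -- `a`, `1`. The two commutators become `a * b⁻¹` and `a⁻¹`, which do not commute.
    have hc := congrArg Subtype.val (h2.commute (hmem 0) (hmem 1)).eq
    have hc' := congrFun (congrArg Prod.snd hc) 1
    simp only [Subgroup.coe_mul, Prod.snd_mul, Pi.mul_apply, Prod.snd_inv, Pi.inv_apply,
      sConj_snd, ← map_inv, ← map_mul] at hc'
    have hx := congrFun (SemidirectProduct.inl_injective hc') 2
    have hk := hkd 1
    rw [hd, PNat.one_coe] at hk
    have h1 := intCast_ne_zero_of_abs_lt (m := k 1) (z := 1) one_ne_zero (by rw [abs_lt]; omega)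
    have h2 := intCast_ne_zero_of_abs_lt (m := k 1) (z := 2) two_ne_zero (by rw [abs_lt]; omega)
    push_cast at h1 h2
    have e0 : sigma (k 1) (d 1) (2 - (0 : ℤ)) = b := by
      rw [sigma, if_neg, if_pos]
      · rw [hd]; push_cast; norm_num
      · intro h
        push_cast at h
        exact h1 (by linear_combination h)
    have e1 : sigma (k 1) (d 1) (2 - (1 : ℤ)) = a := by
      rw [sigma, if_pos (by push_cast; ring)]
    have e2 : sigma (k 1) (d 1) (2 - (2 : ℤ)) = 1 := by
      rw [sigma, if_neg, if_neg]
      · intro h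
        rw [hd] at h
        push_cast at h
        exact h2 (by linear_combination -h)
      · intro h
        push_cast at h
        exact h1 (by linear_combination -h)
    change sigma (k 1) (d 1) (2 - (1 : ℤ)) * (sigma (k 1) (d 1) (2 - (0 : ℤ)))⁻¹ *
        (sigma (k 1) (d 1) (2 - (2 : ℤ)) * (sigma (k 1) (d 1) (2 - (1 : ℤ)))⁻¹) =
      sigma (k 1) (d 1) (2 - (2 : ℤ)) * (sigma (k 1) (d 1) (2 - (1 : ℤ)))⁻¹ *
        (sigma (k 1) (d 1) (2 - (1 : ℤ)) * (sigma (k 1) (d 1) (2 - (0 : ℤ)))⁻¹) at hx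
    rw [e0, e1, e2] at hx
    exact absurd hx (by decide)

end DihedralConstruction

/-! ### The main theorem -/

theorem mainTheorem1 (d k : ℕ+ → ℕ) (hd : ∀ n : ℕ+, d n = (n : ℕ) + 1)
    (hk : StrictMono k) (hkd : ∀ n : ℕ+, 2 * d n ≤ k n) :
    Group.FG (DihedralConstruction.G d k) ∧
    GroupStepSolvable (DihedralConstruction.G d k) 3 ∧
    GroupTorsionFree (DihedralConstruction.G d k) ∧
    (∃ A : Subgroup (DihedralConstruction.G d k), A.Normal ∧ GroupFreeAbelianInfiniteRank A) ∧
    (∀ (Q : Type*) [Group Q], GroupSubquotient Q (DihedralConstruction.G d k) →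
      Group.FG Q → GroupTorsionFree Q → GroupMetabelian Q → GroupVirtuallyAbelian Q) := by
  refine ⟨?_, DihedralConstruction.stepSolvable_G hd hkd,
    DihedralConstruction.torsionFree_G hd hkd, ?_, ?_⟩
  · exact (Group.fg_iff_subgroup_fg _).mpr
      ((Subgroup.fg_iff _).mpr ⟨{DihedralConstruction.s d k, DihedralConstruction.t k}, rfl,
        Set.toFinite _⟩)
  · refine ⟨(DihedralConstruction.finEvenRotations k).subgroupOf _, inferInstance, ?_⟩
    obtain ⟨ι, hι, ⟨e⟩⟩ := DihedralConstruction.isFreeAbelian_finEvenRotations (k := k) fun n => by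
      have := hkd n
      rw [hd] at this
      omega
    exact ⟨ι, hι, ⟨(Subgroup.subgroupOfEquivOfLe
      (DihedralConstruction.finEvenRotations_le_G hd hkd)).trans e⟩⟩
  · rintro Q _ ⟨H, K, hK, ⟨e⟩⟩ hfg htf hmet
    refine LargelySqLocallyCentral.virtuallyAbelian hfg htf hmet ?_
    exact (((DihedralConstruction.largelySqLocallyCentral_G hd hkd).subgroup H).of_surjective _
      (QuotientGroup.mk'_surjective K)).of_surjective e.symm.toMonoidHom e.symm.surjective
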